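/- Let $\rho$ range over the two-qubit states, i.e. the positive semidefinite operators of trace one on $\mathbb{C}^2\otimes\mathbb{C}^2$. For $i\in\{x,z\}$ and $q>1$ let $$S_{ii}^{(q)}(\rho)=\frac{1}{q-1}\Big(1-\sum_{a,b=\pm1}p_{ab}^{\,q}\Big),\qquad p_{ab}=\operatorname{tr}\Big[\rho\,\Big(\tfrac{\mathbb 1+a\sigma_i}{2}\otimes\tfrac{\mathbb 1+b\sigma_i}{2}\Big)\Big],$$ be the Tsallis-$q$ entropy of the four outcome probabilities of the local measurement $\sigma_i\otimes\sigma_i$, where $\sigma_x,\sigma_z$ are Pauli matrices. For $1\le t<\infty$ let $$|\psi_t\rangle=\frac{1}{\sqrt{3+t^2}}\big(t|00\rangle+|01\rangle+|10\rangle+|11\rangle\big),\qquad B_q(t)=\frac{1}{q-1}\Big(1-\frac{3+t^{2q}}{(3+t^2)^q}\Big),$$ and let $|\psi_\infty\rangle=|00\rangle$ and $B_q(\infty)=\lim_{t\to\infty}B_q(t)=0$. Write $S_{ii}^{(q)}(\psi_t)$ for $S_{ii}^{(q)}(|\psi_t\rangle\langle\psi_t|)$. Let $q,\tilde q\ge 2$.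 1. For every two-qubit state $\rho$ there is a unique $t\in[1,\infty]$ with $S_{xx}^{(\tilde q)}(\psi_t)=S_{xx}^{(\tilde q)}(\rho)$, and for this $t$ $$S_{zz}^{(q)}(\rho)\;\ge\;S_{zz}^{(q)}(\psi_t)=B_q(t).$$ 2. The relation is optimal: each $|\psi_t\rangle$, $t\in[1,\infty]$, is a state with $S_{zz}^{(q)}(\psi_t)=B_q(t)$, so it saturates the bound, and for every two-qubit state $\rho$ there is a $t\in[1,\infty]$ with $S_{zz}^{(q)}(\psi_t)=S_{zz}^{(q)}(\rho)$. 3. For $q=\tilde q=2$ and every two-qubit state $\rho$, put $T=\sqrt{9-12\,S_{xx}^{(2)}(\rho)}$ and $Q=3+T+\sqrt3\,\sqrt{(1+T)(3-T)}$, where both radicands that depend on $\rho$ are nonnegative. With $t$ as in 1, $$S_{zz}^{(2)}(\rho)\;\ge\;B_2(t)=\frac{3QT^2-T^4}{3Q^2}.$$ -/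

import Mathlib

open scoped Kronecker ENNReal ComplexOrder

noncomputable section

namespace TwoQubit

/-- Operators on `ℂ² ⊗ ℂ²`, in the computational basis `|ij⟩`, `i, j ∈ {0, 1}`. -/
abbrev Op := Matrix (Fin 2 × Fin 2) (Fin 2 × Fin 2) ℂ

/-- Two-qubit states: positive semidefinite operators of trace one. -/
def IsState (ρ : Op) : Prop := ρ.PosSemidef ∧ ρ.trace = 1

/-- The Pauli matrix `σ_x`. -/
def pauliX : Matrix (Fin 2) (Fin 2) ℂ := !![0, 1; 1, 0]

/-- The Pauli matrix `σ_z`. -/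
def pauliZ : Matrix (Fin 2) (Fin 2) ℂ := !![1, 0; 0, -1]

/-- The projector `(1 ± A) / 2` onto the eigenspace of a Pauli matrix `A` for the outcome `+1`
(`a = 0`) or `-1` (`a = 1`). -/
def outcomeProj (A : Matrix (Fin 2) (Fin 2) ℂ) (a : Fin 2) : Matrix (Fin 2) (Fin 2) ℂ :=
  (1 / 2 : ℂ) • (1 + (-1 : ℂ) ^ (a : ℕ) • A)

/-- The probability `tr (ρ (P_a ⊗ P_b))` of the pair of outcomes `(a, b)` when `A` is measured
locally on both qubits in the state `ρ`. -/
def outcomeProb (A : Matrix (Fin 2) (Fin 2) ℂ) (ρ : Op) (ab : Fin 2 × Fin 2) : ℝ :=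
  (ρ * (outcomeProj A ab.1 ⊗ₖ outcomeProj A ab.2)).trace.re

/-- The Tsallis-`q` entropy of a finite probability vector. -/
def tsallis {ι : Type*} [Fintype ι] (q : ℝ) (p : ι → ℝ) : ℝ :=
  1 / (q - 1) * (1 - ∑ j, p j ^ q)

/-- `S_xx^(q)(ρ)`. -/
def Sxx (q : ℝ) (ρ : Op) : ℝ := tsallis q (outcomeProb pauliX ρ)

/-- `S_zz^(q)(ρ)`. -/
def Szz (q : ℝ) (ρ : Op) : ℝ := tsallis q (outcomeProb pauliZ ρ)

/-- The vector `|ψ_t⟩ = (t |00⟩ + |01⟩ + |10⟩ + |11⟩) / √(3 + t²)`, with `|ψ_∞⟩ = |00⟩`. -/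
def ketPsi (t : ℝ≥0∞) (ij : Fin 2 × Fin 2) : ℂ :=
  if t = ⊤ then (if ij = (0, 0) then 1 else 0)
  else (((if ij = (0, 0) then t.toReal else 1) / Real.sqrt (3 + t.toReal ^ 2) : ℝ) : ℂ)

/-- The pure state `|ψ_t⟩⟨ψ_t|`. -/
def psi (t : ℝ≥0∞) : Op := Matrix.vecMulVec (ketPsi t) (star (ketPsi t))

/-- The bound `(1 - (3 + t^(2q)) / (3 + t²)^q) / (q - 1)`, with its limit `0` at `t = ∞`. -/
def bound (q : ℝ) (t : ℝ≥0∞) : ℝ :=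
  if t = ⊤ then 0
  else 1 / (q - 1) * (1 - (3 + t.toReal ^ (2 * q)) / (3 + t.toReal ^ 2) ^ q)

/-- `T = √(9 - 12 S)`. -/
def closedT (S : ℝ) : ℝ := Real.sqrt (9 - 12 * S)

/-- `Q = 3 + T + √3 √((1 + T) (3 - T))`. -/
def closedQ (S : ℝ) : ℝ :=
  3 + closedT S + Real.sqrt 3 * Real.sqrt ((1 + closedT S) * (3 - closedT S))

/-- The closed form `(3 Q T² - T⁴) / (3 Q²)` of the bound for `q = q̃ = 2`. -/
def closedBound (S : ℝ) : ℝ :=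
  (3 * closedQ S * closedT S ^ 2 - closedT S ^ 4) / (3 * closedQ S ^ 2)

end TwoQubit

end

/-! For a distribution p on four points let T = √(12 ∑ p² − 3) be its `deviation`. With the first
two power sums fixed and q ≥ 2, ∑ p^q is largest on the flat distribution, one large and three equal
small entries (`sum_rpow_le_flatSum`), where it strictly increases with T. This reduces all
exponents to the pair (T, U) of z- and x-deviations, and ψ_t is flat in both bases.

For a real vector, T² + 2U² is determined by the norm and the product of the amplitudes. Bounding
that product at fixed T confines (T, U) to an ellipse (`quadric_le_of_real_vector`) with the ψ_t on
its boundary. The tangent inequalities at ψ_t are linear and the deviation is a seminorm, so they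
extend to sums of real rank-one operators. The real part of every state is such a sum, and both
measurements see only this real part. Equal x-entropies force `devX t` ≤ U, the tangents then give T
≤ `devZ t` (`deviation_pauliZ_le`), and monotonicity of the flat sums yields the bound. -/

/-! ### Extremal vectors for two fixed power sums -/

/-- If `h'` is convex on `s` and `h` vanishes to second order at `b` and vanishes at `a > b`, then
`h ≤ 0` on `s` to the left of `a`. -/
theorem nonpos_of_convexOn_deriv {s : Set ℝ} {h h' : ℝ → ℝ} {a b x : ℝ}
    (hconv : ConvexOn ℝ s h') (hder : ∀ y ∈ s, HasDerivAt h (h' y) y)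
    (ha : a ∈ s) (hb : b ∈ s) (hba : b < a) (hha : h a = 0) (hhb : h b = 0) (hhb' : h' b = 0)
    (hx : x ∈ s) (hxa : x ≤ a) : h x ≤ 0 := by
  have hord := hconv.1.ordConnected
  have hcont : ∀ {u v : ℝ}, u ∈ s → v ∈ s → ContinuousOn h (Set.Icc u v) := fun hu hv y hy =>
    (hder y (hord.out hu hv hy)).continuousAt.continuousWithinAt
  -- Rolle gives a second zero c of the convex `h'`, which is therefore ≥ 0 left of b, ≤ 0 on [b, c]
  -- and ≥ 0 right of c: h rises to 0 at b, dips, and rises back to 0 at a.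
  obtain ⟨c, ⟨hbc, hca⟩, hc⟩ := exists_hasDerivAt_eq_zero hba (hcont hb ha) (hhb.trans hha.symm)
    fun y hy => hder y (hord.out hb ha (Set.Ioo_subset_Icc_self hy))
  have hcs : c ∈ s := hord.out hb ha ⟨hbc.le, hca.le⟩
  have hmono : ∀ {u v : ℝ}, u ∈ s → v ∈ s → u ≤ v → (∀ y ∈ Set.Ioo u v, 0 ≤ h' y) → h u ≤ h v := by
    intro u v hu hv huv hpos
    refine monotoneOn_of_deriv_nonneg (convex_Icc u v) (hcont hu hv) ?_ ?_
      (Set.left_mem_Icc.2 huv) (Set.right_mem_Icc.2 huv) huv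
    · intro y hy
      rw [interior_Icc] at hy
      exact (hder y (hord.out hu hv (Set.Ioo_subset_Icc_self hy))).differentiableAt
        |>.differentiableWithinAt
    · intro y hy
      rw [interior_Icc] at hy
      rw [(hder y (hord.out hu hv (Set.Ioo_subset_Icc_self hy))).deriv]
      exact hpos y hy
  rcases le_total x b with hxb | hbx
  · rw [← hhb]
    refine hmono hx hb hxb fun y hy => ?_
    have hys := hord.out hx hb (Set.Ioo_subset_Icc_self hy)
    have hsl := hconv.slope_mono_adjacent hys hcs hy.2 hbc
    rw [hhb', hc] at hsl
    have h2 : 0 < b - y := sub_pos.2 hy.2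
    rw [sub_zero, zero_div, div_le_iff₀ h2] at hsl
    linarith
  rcases le_total x c with hxc | hcx
  · rw [← hhb]
    refine (antitoneOn_of_deriv_nonpos (convex_Icc b c) (hcont hb hcs) ?_ ?_)
      (Set.left_mem_Icc.2 hbc.le) ⟨hbx, hxc⟩ hbx
    · intro y hy
      rw [interior_Icc] at hy
      exact (hder y (hord.out hb hcs (Set.Ioo_subset_Icc_self hy))).differentiableAt
        |>.differentiableWithinAt
    · intro y hy
      rw [interior_Icc] at hy
      rw [(hder y (hord.out hb hcs (Set.Ioo_subset_Icc_self hy))).deriv]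
      have := hconv.le_max_of_mem_Icc hb hcs (Set.Ioo_subset_Icc_self hy)
      simpa [hhb', hc] using this
  · rw [← hha]
    refine hmono hx ha hxa fun y hy => ?_
    have hys := hord.out hx ha (Set.Ioo_subset_Icc_self hy)
    have hcy : c < y := lt_of_le_of_lt hcx hy.1
    have hsl := hconv.slope_mono_adjacent hb hys hbc hcy
    rw [hhb', hc, sub_zero, zero_div] at hsl
    rwa [sub_zero, le_div_iff₀ (sub_pos.2 hcy), zero_mul] at hsl

/-- Among the vectors of given length and given power sums of degrees one and two, the ones of the
form `(a, b, …, b)` with `b ≤ a` have the largest `∑ f`, if `f'` is convex. -/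
theorem sum_le_of_convexOn_deriv {ι : Type*} [Fintype ι] {N : ℕ} (hN : Fintype.card ι = N + 1)
    {s : Set ℝ} {f f' : ℝ → ℝ} (hconv : ConvexOn ℝ s f') (hder : ∀ y ∈ s, HasDerivAt f (f' y) y)
    {a b : ℝ} (ha : a ∈ s) (hb : b ∈ s) (hba : b ≤ a) {p : ι → ℝ} (hp : ∀ i, p i ∈ s)
    (h1 : ∑ i, p i = a + N * b) (h2 : ∑ i, p i ^ 2 = a ^ 2 + N * b ^ 2) :
    ∑ i, f (p i) ≤ f a + N * f b := by
  classical
  rcases hba.eq_or_lt with rfl | hba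
  · have hz : ∑ i, (p i - b) ^ 2 = 0 := by
      have : ∀ i, (p i - b) ^ 2 = p i ^ 2 - 2 * b * p i + b ^ 2 := fun i => by ring
      simp_rw [this, Finset.sum_add_distrib, Finset.sum_sub_distrib, ← Finset.mul_sum, h1, h2]
      simp [hN]; ring
    have hpb : ∀ i, p i = b := fun i => by
      have := (Finset.sum_eq_zero_iff_of_nonneg fun i _ => sq_nonneg (p i - b)).1 hz i
        (Finset.mem_univ i)
      exact sub_eq_zero.1 (pow_eq_zero_iff two_ne_zero |>.1 this)
    simp [hpb, hN]; linarith
  -- An entry above a would leave the other N entries a sum of squares below the Cauchy–Schwarz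
  -- minimum.
  have hpa : ∀ i, p i ≤ a := by
    intro i
    by_contra! hlt
    have hcs := sq_sum_le_card_mul_sum_sq (s := Finset.univ.erase i) (f := p)
    have e1 := Finset.add_sum_erase Finset.univ p (Finset.mem_univ i)
    have e2 := Finset.add_sum_erase Finset.univ (fun j => p j ^ 2) (Finset.mem_univ i)
    rw [Finset.card_erase_of_mem (Finset.mem_univ i), Finset.card_univ, hN, Nat.add_sub_cancel,
      show ∑ j ∈ Finset.univ.erase i, p j = a + N * b - p i by linarith,
      show ∑ j ∈ Finset.univ.erase i, p j ^ 2 = a ^ 2 + N * b ^ 2 - p i ^ 2 by linarith] at hcs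
    have hNn : (0 : ℝ) ≤ N := N.cast_nonneg
    have : 0 < (p i - a) * ((p i - a) + N * (p i - a) + 2 * N * (a - b)) := by
      refine mul_pos (by linarith) ?_
      have := mul_nonneg hNn (sub_nonneg.2 hlt.le)
      have := mul_nonneg hNn (sub_nonneg.2 hba.le)
      linarith
    nlinarith
  -- k makes the quadratic g, tangent to f at b, also meet f at a. Then f ≤ g up to a, while ∑ g (p
  -- i) depends only on the two power sums.
  set k := (f a - f b - f' b * (a - b)) / (a - b) ^ 2 with hk
  have hab : a - b ≠ 0 := (sub_pos.2 hba).ne'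
  set g : ℝ → ℝ := fun x => f b + f' b * (x - b) + k * (x - b) ^ 2 with hg
  have hga : g a = f a := by simp only [hg, hk]; field_simp; ring
  have hgle : ∀ i, f (p i) ≤ g (p i) := by
    intro i
    have := nonpos_of_convexOn_deriv (s := s) (h := fun x => f x - g x)
      (h' := fun x => f' x - (f' b + k * (2 * (x - b)))) (x := p i) ?_ ?_ ha hb hba
      (by simp [hga]) (by simp [hg]) (by simp) (hp i) (hpa i)
    · simpa using this
    · refine hconv.sub ?_
      refine ⟨hconv.1, fun x _ y _ u v _ _ huv => le_of_eq ?_⟩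
      have : v = 1 - u := by linarith
      subst this
      simp only [smul_eq_mul]; ring
    · intro y hy
      refine (hder y hy).sub ?_
      have h := ((hasDerivAt_id y).sub_const b)
      have := ((h.const_mul (f' b)).const_add (f b)).add ((h.pow 2).const_mul k)
      refine (this.congr_deriv ?_).congr_of_eventuallyEq (Filter.Eventually.of_forall fun x => ?_)
      · simp
      · simp [hg]
  refine (Finset.sum_le_sum fun i _ => hgle i).trans (le_of_eq ?_)
  have e : ∀ i, g (p i) = (f b - f' b * b + k * b ^ 2) + (f' b - 2 * k * b) * p i + k * p i ^ 2 :=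
    fun i => by simp only [hg]; ring
  simp_rw [e, Finset.sum_add_distrib, ← Finset.mul_sum, h1, h2]
  rw [← hga]
  simp [hN, hg]; ring

/-- q ≥ 2 is what makes the derivative q x^(q-1) convex on [0, ∞). -/
theorem sum_rpow_le_of_convexOn {ι : Type*} [Fintype ι] {N : ℕ} (hN : Fintype.card ι = N + 1)
    {q : ℝ} (hq : 2 ≤ q) {a b : ℝ} (hb : 0 ≤ b) (hba : b ≤ a) {p : ι → ℝ} (hp : ∀ i, 0 ≤ p i)
    (h1 : ∑ i, p i = a + N * b) (h2 : ∑ i, p i ^ 2 = a ^ 2 + N * b ^ 2) :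
    ∑ i, p i ^ q ≤ a ^ q + N * b ^ q :=
  sum_le_of_convexOn_deriv (s := Set.Ici 0) (f := fun x => x ^ q) (f' := fun x => q * x ^ (q - 1))
    hN ((convexOn_rpow (by linarith)).smul (by linarith))
    (fun y _ => Real.hasDerivAt_rpow_const (Or.inr (by linarith))) (hb.trans hba) hb hba hp h1 h2

/-- The same principle for `Real.log`, whose derivative 1/x is convex on (0, ∞); zero entries and b
= 0 are treated apart. -/
theorem prod_le_of_sum_of_sum_sq {ι : Type*} [Fintype ι] {N : ℕ} (hN : Fintype.card ι = N + 1)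
    {a b : ℝ} (hb : 0 ≤ b) (hba : b ≤ a) {p : ι → ℝ} (hp : ∀ i, 0 ≤ p i)
    (h1 : ∑ i, p i = a + N * b) (h2 : ∑ i, p i ^ 2 = a ^ 2 + N * b ^ 2) :
    ∏ i, p i ≤ a * b ^ N := by
  by_cases hpos : ∀ i, 0 < p i
  swap
  · push Not at hpos
    obtain ⟨i, hi⟩ := hpos
    rw [Finset.prod_eq_zero (Finset.mem_univ i) (le_antisymm hi (hp i))]
    exact mul_nonneg (hb.trans hba) (pow_nonneg hb N)
  rcases hb.eq_or_lt with rfl | hb'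
  · simp only [mul_zero, add_zero, ne_eq, two_ne_zero, not_false_eq_true, zero_pow] at h1 h2
    have hle : ∀ i, p i ≤ a := fun i =>
      h1 ▸ Finset.single_le_sum (fun j _ => hp j) (Finset.mem_univ i)
    have hz : ∑ i, p i * (a - p i) = 0 := by
      simp_rw [mul_sub, Finset.sum_sub_distrib, ← Finset.sum_mul, ← sq, h1, h2]
      ring
    have hpa : ∀ i, p i = a := fun i => by
      have := (Finset.sum_eq_zero_iff_of_nonneg
        fun i _ => mul_nonneg (hp i) (sub_nonneg.2 (hle i))).1 hz i (Finset.mem_univ i)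
      rcases mul_eq_zero.1 this with h | h
      · exact absurd h (hpos i).ne'
      · linarith
    have : Nonempty ι := Fintype.card_pos_iff.1 (by omega)
    have ha : 0 < a := hpa (Classical.arbitrary ι) ▸ hpos _
    simp only [hpa, Finset.sum_const, Finset.card_univ, hN, nsmul_eq_mul] at h1
    push_cast at h1
    have hN0 : (N : ℝ) = 0 := by
      have : (N : ℝ) * a = 0 := by linarith
      exact (mul_eq_zero.1 this).resolve_right ha.ne'
    have hN0 : N = 0 := by exact_mod_cast hN0
    simp [hpa, hN, hN0]
  · have ha : 0 < a := hb'.trans_le hba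
    have hconv : ConvexOn ℝ (Set.Ioi (0 : ℝ)) fun x => x⁻¹ := by
      simpa using convexOn_zpow (𝕜 := ℝ) (-1)
    have := sum_le_of_convexOn_deriv (f := Real.log) hN hconv
      (fun y hy => Real.hasDerivAt_log (ne_of_gt hy)) ha hb' hba hpos h1 h2
    rw [← Real.log_prod fun i _ => (hpos i).ne', ← Real.log_pow,
      ← Real.log_mul ha.ne' (pow_pos hb' N).ne'] at this
    exact (Real.log_le_log_iff (Finset.prod_pos fun i _ => hpos i)
      (mul_pos ha (pow_pos hb' N))).1 this

namespace TwoQubit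

/-! ### Deviation from the uniform distribution -/

/-- The deviation `√(12 ∑ p² - 3 (∑ p)²)` from the uniform distribution, for vectors indexed by
four points. It takes values in `[0, 3]` on probability vectors. -/
noncomputable def deviation (p : Fin 2 × Fin 2 → ℝ) : ℝ :=
  √(12 * ∑ i, p i ^ 2 - 3 * (∑ i, p i) ^ 2)

/-- The Hadamard transform of a real amplitude vector of two qubits. -/
noncomputable def hadamard (v : Fin 2 × Fin 2 → ℝ) (i : Fin 2 × Fin 2) : ℝ :=
  1 / 2 * ∑ j, (-1) ^ ((i.1 : ℕ) * j.1 + (i.2 : ℕ) * j.2) * v j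

/-- `∑ p^q` for the distribution `((1 + T) / 4, (3 - T) / 12, (3 - T) / 12, (3 - T) / 12)`. -/
noncomputable def flatSum (q T : ℝ) : ℝ := ((1 + T) / 4) ^ q + 3 * ((3 - T) / 12) ^ q

theorem deviation_radicand_nonneg (p : Fin 2 × Fin 2 → ℝ) :
    0 ≤ 12 * ∑ i, p i ^ 2 - 3 * (∑ i, p i) ^ 2 := by
  have := sq_sum_le_card_mul_sum_sq (s := Finset.univ) (f := p)
  simp only [Finset.card_univ, Fintype.card_prod, Fintype.card_fin] at this
  push_cast at this
  linarith

theorem deviation_nonneg (p : Fin 2 × Fin 2 → ℝ) : 0 ≤ deviation p := Real.sqrt_nonneg _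

theorem sq_deviation (p : Fin 2 × Fin 2 → ℝ) :
    deviation p ^ 2 = 12 * ∑ i, p i ^ 2 - 3 * (∑ i, p i) ^ 2 :=
  Real.sq_sqrt (deviation_radicand_nonneg p)

theorem deviation_le {p : Fin 2 × Fin 2 → ℝ} (hp : ∀ i, 0 ≤ p i) :
    deviation p ≤ 3 * ∑ i, p i := by
  have hs : 0 ≤ ∑ i, p i := Finset.sum_nonneg fun i _ => hp i
  refine abs_le_of_sq_le_sq' ?_ (by positivity) |>.2
  rw [sq_deviation]
  have := Finset.sum_sq_le_sq_sum_of_nonneg (s := Finset.univ) fun i _ => hp i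
  linarith

/-- A Euclidean norm of a linear image, which supplies the triangle inequality needed for mixed
states. -/
theorem deviation_eq_norm (p : Fin 2 × Fin 2 → ℝ) :
    deviation p = ‖WithLp.toLp 2 (fun i => √12 * (p i - (∑ j, p j) / 4))‖ := by
  rw [EuclideanSpace.norm_eq, deviation]
  congr 1
  simp only [Real.norm_eq_abs, sq_abs, mul_pow, Real.sq_sqrt (show (0 : ℝ) ≤ 12 by norm_num)]
  simp only [Fintype.sum_prod_type, Fin.sum_univ_two]
  ring

theorem deviation_sum_le {κ : Type*} (s : Finset κ) (p : κ → Fin 2 × Fin 2 → ℝ) :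
    deviation (fun i => ∑ k ∈ s, p k i) ≤ ∑ k ∈ s, deviation (p k) := by
  simp_rw [deviation_eq_norm]
  refine le_of_eq_of_le ?_ (norm_sum_le _ _)
  congr 1
  ext i
  simp only [WithLp.ofLp_sum, Finset.sum_apply]
  rw [← Finset.mul_sum, Finset.sum_sub_distrib, ← Finset.sum_div, Finset.sum_comm]

theorem sum_eq_of_deviation {p : Fin 2 × Fin 2 → ℝ} :
    ∑ i, p i = (∑ i, p i + deviation p) / 4 + (3 : ℕ) * ((3 * ∑ i, p i - deviation p) / 12) := by
  push_cast; ring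

theorem sum_sq_eq_of_deviation {p : Fin 2 × Fin 2 → ℝ} :
    ∑ i, p i ^ 2 = ((∑ i, p i + deviation p) / 4) ^ 2 +
      (3 : ℕ) * ((3 * ∑ i, p i - deviation p) / 12) ^ 2 := by
  have := sq_deviation p
  push_cast; linear_combination -1 / 12 * this

theorem sum_rpow_le_flatSum {q : ℝ} (hq : 2 ≤ q) {p : Fin 2 × Fin 2 → ℝ} (hp : ∀ i, 0 ≤ p i)
    (h1 : ∑ i, p i = 1) : ∑ i, p i ^ q ≤ flatSum q (deviation p) := by
  have h0 := deviation_nonneg p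
  have h3 := deviation_le hp
  have e1 := sum_eq_of_deviation (p := p)
  have e2 := sum_sq_eq_of_deviation (p := p)
  have := sum_rpow_le_of_convexOn (by simp) hq (by linarith) (by linarith) hp e1 e2
  simpa [flatSum, h1] using this

theorem prod_le_of_deviation {p : Fin 2 × Fin 2 → ℝ} (hp : ∀ i, 0 ≤ p i) :
    ∏ i, p i ≤
      (∑ i, p i + deviation p) / 4 * ((3 * ∑ i, p i - deviation p) / 12) ^ 3 := by
  have h0 := deviation_nonneg p
  have h3 := deviation_le hp
  exact prod_le_of_sum_of_sum_sq (by simp) (by linarith) (by linarith) hp sum_eq_of_deviation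
    sum_sq_eq_of_deviation

/-! ### The trade-off for real vectors -/

theorem sum_sq_hadamard (v : Fin 2 × Fin 2 → ℝ) : ∑ i, hadamard v i ^ 2 = ∑ i, v i ^ 2 := by
  simp only [hadamard, Fintype.sum_prod_type, Fin.sum_univ_two]
  simp
  ring

/-- Once the norm and the z-deviation are given, the x-deviation depends on v only through ∏ v. -/
theorem sq_deviation_add_hadamard (v : Fin 2 × Fin 2 → ℝ) :
    deviation (fun i => v i ^ 2) ^ 2 + 2 * deviation (fun i => hadamard v i ^ 2) ^ 2 =
      9 * (∑ i, v i ^ 2) ^ 2 + 144 * ∏ i, v i := by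
  rw [sq_deviation, sq_deviation, sum_sq_hadamard]
  simp only [hadamard, Fintype.sum_prod_type, Fin.sum_univ_two, Fintype.prod_prod_type,
    Fin.prod_univ_two]
  simp
  ring

theorem quadric_le_of_real_vector (v : Fin 2 × Fin 2 → ℝ) {n T U : ℝ} (hn : n = ∑ i, v i ^ 2)
    (hT : T = deviation fun i => v i ^ 2) (hU : U = deviation fun i => hadamard v i ^ 2) :
    T ^ 2 + U ^ 2 + T * U ≤ 3 * n * (T + U) := by
  have hT0 : 0 ≤ T := hT ▸ deviation_nonneg _
  have hU0 : 0 ≤ U := hU ▸ deviation_nonneg _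
  have hT3 : T ≤ 3 * n := by rw [hT, hn]; exact deviation_le fun i => sq_nonneg _
  have hsum := sq_deviation_add_hadamard v
  have hprod := prod_le_of_deviation (p := fun i => v i ^ 2) fun i => sq_nonneg _
  rw [Finset.prod_pow] at hprod
  rw [← hn, ← hT] at hprod
  rw [← hn, ← hT, ← hU] at hsum
  set π := ∏ i, v i
  have hnT : 0 ≤ n + T := by linarith
  have h3T : 0 ≤ 3 * n - T := by linarith
  -- s² is the discriminant of the quadric in U, with roots (3n − T ± s)/2. The product bound puts U
  -- below the larger root; the smaller one is nonpositive.
  set s := √(3 * ((n + T) * (3 * n - T))) with hs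
  have hs0 : 0 ≤ s := Real.sqrt_nonneg _
  have hs2 : s ^ 2 = 3 * ((n + T) * (3 * n - T)) := Real.sq_sqrt (by positivity)
  have hπ : 144 * π ≤ (3 * n - T) * s := by
    refine abs_le_of_sq_le_sq' ?_ (by positivity) |>.2
    rw [mul_pow _ s, hs2]
    linarith
  have hle : U ≤ (3 * n - T + s) / 2 := by
    refine abs_le_of_sq_le_sq' ?_ (by positivity) |>.2
    linarith
  have hge : 3 * n - T ≤ s := by
    refine abs_le_of_sq_le_sq' ?_ hs0 |>.2
    rw [hs2, sq]
    have := mul_nonneg hT0 h3T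
    linarith
  have := mul_nonneg (sub_nonneg.2 hle) (show 0 ≤ U - (3 * n - T - s) / 2 by linarith)
  linarith

/-- Left side times T + U equals (t + 1)² (T² + U² + TU) − (2T − (t − 1)U)²; the square vanishes in
the direction of ψ_t. -/
theorem tangent_le_of_real_vector (v : Fin 2 × Fin 2 → ℝ) (t : ℝ) :
    (t + 3) * (t - 1) * deviation (fun i => v i ^ 2) +
      4 * t * deviation (fun i => hadamard v i ^ 2) ≤ 3 * (t + 1) ^ 2 * ∑ i, v i ^ 2 := by
  have hG := quadric_le_of_real_vector v rfl rfl rfl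
  have hT := deviation_nonneg fun i => v i ^ 2
  have hU := deviation_nonneg fun i => hadamard v i ^ 2
  have hn : 0 ≤ ∑ i, v i ^ 2 := Finset.sum_nonneg fun i _ => sq_nonneg _
  generalize deviation (fun i => v i ^ 2) = T at *
  generalize deviation (fun i => hadamard v i ^ 2) = U at *
  generalize ∑ i, v i ^ 2 = n at *
  rcases (add_nonneg hT hU).eq_or_lt with h | h
  · have hT' : T = 0 := by linarith
    have hU' : U = 0 := by linarith
    subst hT' hU'
    simp only [mul_zero, add_zero]
    positivity
  · refine le_of_mul_le_mul_right ?_ h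
    have h1 := mul_le_mul_of_nonneg_left hG (sq_nonneg (t + 1))
    have h2 := sq_nonneg (2 * T - (t - 1) * U)
    linarith

/-! ### From real vectors to states -/

open scoped MatrixOrder Matrix.Norms.L2Operator in
/-- The Gram representation of the real part of a positive semidefinite operator. -/
theorem exists_real_gram {ρ : Op} (hρ : ρ.PosSemidef) :
    ∃ v : Fin 2 × Fin 2 × Fin 2 → Fin 2 × Fin 2 → ℝ,
      ∀ i j, (ρ i j).re = ∑ k, v k i * v k j := by
  obtain ⟨B, rfl⟩ := CStarAlgebra.nonneg_iff_eq_star_mul_self.1 (Matrix.nonneg_iff_posSemidef.2 hρ)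
  -- Each row of B splits into its real and imaginary parts, selected by the first coordinate of k.
  refine ⟨fun k i => if k.1 = 0 then (B k.2 i).re else (B k.2 i).im, fun i j => ?_⟩
  rw [Fintype.sum_prod_type]
  simp [Matrix.mul_apply, Matrix.star_apply, Finset.sum_add_distrib]

theorem outcomeProb_pauliZ {κ : Type*} [Fintype κ] {ρ : Op} {v : κ → Fin 2 × Fin 2 → ℝ}
    (hv : ∀ i j, (ρ i j).re = ∑ k, v k i * v k j) :
    outcomeProb pauliZ ρ = fun i => ∑ k, v k i ^ 2 := by
  funext i
  have : outcomeProb pauliZ ρ i = (ρ i i).re := by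
    obtain ⟨a, b⟩ := i
    fin_cases a <;> fin_cases b <;>
    simp [outcomeProb, outcomeProj, pauliZ, Matrix.trace, Matrix.mul_apply, Fintype.sum_prod_type,
      Fin.sum_univ_two, Matrix.kroneckerMap_apply, Matrix.one_apply] <;> norm_num
  rw [this, hv]
  simp_rw [sq]

theorem outcomeProb_pauliX {κ : Type*} [Fintype κ] {ρ : Op} {v : κ → Fin 2 × Fin 2 → ℝ}
    (hv : ∀ i j, (ρ i j).re = ∑ k, v k i * v k j) :
    outcomeProb pauliX ρ = fun i => ∑ k, hadamard (v k) i ^ 2 := by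
  funext i
  have h : outcomeProb pauliX ρ i = 1 / 4 * ∑ j, ∑ l,
      (-1) ^ ((i.1 : ℕ) * j.1 + (i.2 : ℕ) * j.2) * (-1) ^ ((i.1 : ℕ) * l.1 + (i.2 : ℕ) * l.2) *
        (ρ j l).re := by
    obtain ⟨a, b⟩ := i
    fin_cases a <;> fin_cases b <;>
    simp [outcomeProb, outcomeProj, pauliX, Matrix.trace, Matrix.mul_apply, Fintype.sum_prod_type,
      Fin.sum_univ_two, Matrix.kroneckerMap_apply, Matrix.one_apply] <;> ring
  have h2 : ∀ k, hadamard (v k) i ^ 2 = 1 / 4 * ∑ j, ∑ l,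
      (-1) ^ ((i.1 : ℕ) * j.1 + (i.2 : ℕ) * j.2) * (-1) ^ ((i.1 : ℕ) * l.1 + (i.2 : ℕ) * l.2) *
        (v k j * v k l) := by
    intro k
    rw [hadamard, mul_pow, show ((1 : ℝ) / 2) ^ 2 = 1 / 4 by norm_num, sq, Finset.sum_mul_sum]
    exact congrArg _ (Finset.sum_congr rfl fun j _ => Finset.sum_congr rfl fun l _ => by ring)
  rw [h, Finset.sum_congr rfl fun k _ => h2 k, ← Finset.mul_sum,
    Finset.sum_comm (s := (Finset.univ : Finset κ))]
  refine congrArg _ (Finset.sum_congr rfl fun j _ => ?_)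
  rw [Finset.sum_comm (s := (Finset.univ : Finset κ))]
  simp_rw [hv, Finset.mul_sum]

/-! ### Power sums of flat distributions -/

theorem flatSum_continuous {q : ℝ} (hq : 2 ≤ q) : Continuous (flatSum q) := by
  have h0 : 0 ≤ q := by linarith
  unfold flatSum
  exact ((by fun_prop : Continuous fun T : ℝ => (1 + T) / 4).rpow_const fun _ => Or.inr h0).add
    (((by fun_prop : Continuous fun T : ℝ => (3 - T) / 12).rpow_const fun _ => Or.inr h0).const_mul 3)

theorem flatSum_strictMonoOn {q : ℝ} (hq : 2 ≤ q) : StrictMonoOn (flatSum q) (Set.Icc 0 3) := by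
  refine strictMonoOn_of_deriv_pos (convex_Icc 0 3) (flatSum_continuous hq).continuousOn ?_
  intro T hT
  rw [interior_Icc] at hT
  have h1 : HasDerivAt (fun T : ℝ => (1 + T) / 4) (1 / 4) T :=
    ((hasDerivAt_id T).const_add 1).div_const 4
  have h2 : HasDerivAt (fun T : ℝ => (3 - T) / 12) (-1 / 12) T :=
    ((hasDerivAt_id T).const_sub 3).div_const 12
  have h := (h1.rpow_const (p := q) (Or.inr (by linarith))).add
    ((h2.rpow_const (p := q) (Or.inr (by linarith))).const_mul 3)
  rw [show deriv (flatSum q) T = _ from h.deriv]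
  -- The derivative is q/4 times the difference of these two powers.
  have hlt : ((3 - T) / 12) ^ (q - 1) < ((1 + T) / 4) ^ (q - 1) :=
    Real.rpow_lt_rpow (by linarith [hT.2]) (by linarith [hT.1]) (by linarith)
  have := mul_pos (show 0 < q by linarith) (sub_pos.2 hlt)
  linarith

theorem flatSum_three {q : ℝ} (hq : 2 ≤ q) : flatSum q 3 = 1 := by
  have : q ≠ 0 := by linarith
  norm_num [flatSum, Real.zero_rpow this]

theorem flatSum_zero_le {q : ℝ} (hq : 2 ≤ q) {p : Fin 2 × Fin 2 → ℝ} (hp : ∀ i, 0 ≤ p i)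
    (h1 : ∑ i, p i = 1) : flatSum q 0 ≤ ∑ i, p i ^ q := by
  have := Real.rpow_arith_mean_le_arith_mean_rpow Finset.univ (fun _ : Fin 2 × Fin 2 => (1 / 4 : ℝ))
    p (fun _ _ => by norm_num) (by norm_num) (fun i _ => hp i) (show 1 ≤ q by linarith)
  rw [← Finset.mul_sum, ← Finset.mul_sum, h1] at this
  have e : (3 : ℝ) / 12 = 1 / 4 := by norm_num
  simp only [flatSum, add_zero, sub_zero, e]
  rw [mul_one] at this
  linarith

theorem exists_flatSum_eq {q : ℝ} (hq : 2 ≤ q) {p : Fin 2 × Fin 2 → ℝ} (hp : ∀ i, 0 ≤ p i)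
    (h1 : ∑ i, p i = 1) : ∃ T ∈ Set.Icc (0 : ℝ) 3, flatSum q T = ∑ i, p i ^ q := by
  refine intermediate_value_Icc (by norm_num) (flatSum_continuous hq).continuousOn
    ⟨flatSum_zero_le hq hp h1, (sum_rpow_le_flatSum hq hp h1).trans ?_⟩
  have h3 : deviation p ≤ 3 := by simpa [h1] using deviation_le hp
  exact (flatSum_strictMonoOn hq).monotoneOn ⟨deviation_nonneg p, h3⟩ (by norm_num) h3

/-- A two-qubit state has nonnegative outcome probabilities that sum to one, and the deviations of
the two local measurements satisfy a family of linear trade-offs. -/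
theorem IsState.outcomeProb_properties {ρ : Op} (hρ : IsState ρ) :
    ((∀ i, 0 ≤ outcomeProb pauliZ ρ i) ∧ ∑ i, outcomeProb pauliZ ρ i = 1) ∧
    ((∀ i, 0 ≤ outcomeProb pauliX ρ i) ∧ ∑ i, outcomeProb pauliX ρ i = 1) ∧
    ∀ t : ℝ, 1 ≤ t → (t + 3) * (t - 1) * deviation (outcomeProb pauliZ ρ) +
      4 * t * deviation (outcomeProb pauliX ρ) ≤ 3 * (t + 1) ^ 2 := by
  obtain ⟨v, hv⟩ := exists_real_gram hρ.1
  have htr : ∑ k, ∑ i, v k i ^ 2 = 1 := by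
    have := congrArg Complex.re hρ.2
    simp only [Matrix.trace, Matrix.diag_apply, Complex.re_sum, Complex.one_re, hv] at this
    rw [Finset.sum_comm]
    simpa only [sq] using this
  rw [outcomeProb_pauliZ hv, outcomeProb_pauliX hv]
  refine ⟨⟨fun i => Finset.sum_nonneg fun k _ => sq_nonneg _, by rw [Finset.sum_comm, htr]⟩,
    ⟨fun i => Finset.sum_nonneg fun k _ => sq_nonneg _, ?_⟩, fun t ht => ?_⟩
  · rw [Finset.sum_comm]
    simpa only [sum_sq_hadamard] using htr
  · have hz := deviation_sum_le Finset.univ fun k i => v k i ^ 2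
    have hx := deviation_sum_le Finset.univ fun k i => hadamard (v k) i ^ 2
    have hα : 0 ≤ (t + 3) * (t - 1) := mul_nonneg (by linarith) (by linarith)
    have hβ : 0 ≤ 4 * t := by linarith
    refine (add_le_add (mul_le_mul_of_nonneg_left hz hα)
      (mul_le_mul_of_nonneg_left hx hβ)).trans ?_
    rw [Finset.mul_sum, Finset.mul_sum, ← Finset.sum_add_distrib]
    refine (Finset.sum_le_sum fun k _ => tangent_le_of_real_vector (v k) t).trans (le_of_eq ?_)
    rw [← Finset.mul_sum, htr, mul_one]

/-! ### The family ψ_t -/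

/-- The deviation of the `σ_z ⊗ σ_z` outcomes in the state `ψ_t`. -/
noncomputable def devZ (t : ℝ≥0∞) : ℝ :=
  if t = ⊤ then 3 else 3 * (t.toReal ^ 2 - 1) / (t.toReal ^ 2 + 3)

/-- The deviation of the `σ_x ⊗ σ_x` outcomes in the state `ψ_t`. -/
noncomputable def devX (t : ℝ≥0∞) : ℝ :=
  if t = ⊤ then 0 else 6 * (t.toReal + 1) / (t.toReal ^ 2 + 3)

theorem one_le_toReal {t : ℝ≥0∞} (ht : 1 ≤ t) (hT : t ≠ ⊤) : 1 ≤ t.toReal := by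
  simpa using ENNReal.toReal_mono hT ht

theorem devZ_mem {t : ℝ≥0∞} (ht : 1 ≤ t) : devZ t ∈ Set.Icc (0 : ℝ) 3 := by
  unfold devZ
  split_ifs with h
  · norm_num
  · have h1 := one_le_toReal ht h
    have h2 : 0 < t.toReal ^ 2 + 3 := by positivity
    refine ⟨div_nonneg ?_ h2.le, (div_le_iff₀ h2).2 ?_⟩ <;> nlinarith

theorem devX_mem {t : ℝ≥0∞} (ht : 1 ≤ t) : devX t ∈ Set.Icc (0 : ℝ) 3 := by
  unfold devX
  split_ifs with h
  · norm_num
  · have h1 := one_le_toReal ht h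
    have h2 : 0 < t.toReal ^ 2 + 3 := by positivity
    refine ⟨div_nonneg ?_ h2.le, (div_le_iff₀ h2).2 ?_⟩ <;> nlinarith [sq_nonneg (t.toReal - 1)]

theorem devX_injOn : Set.InjOn devX (Set.Ici 1) := by
  intro t ht s hs h
  by_cases hT : t = ⊤ <;> by_cases hS : s = ⊤
  · rw [hT, hS]
  · have h1 := one_le_toReal hs hS
    have : 0 < devX s := by rw [devX, if_neg hS]; positivity
    rw [← h, devX, if_pos hT] at this
    exact absurd this (lt_irrefl _)
  · have h1 := one_le_toReal ht hT
    have : 0 < devX t := by rw [devX, if_neg hT]; positivity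
    rw [h, devX, if_pos hS] at this
    exact absurd this (lt_irrefl _)
  · have h1 := one_le_toReal hs hS
    have h2 := one_le_toReal ht hT
    rw [devX, devX, if_neg hT, if_neg hS, div_eq_div_iff (by positivity) (by positivity)] at h
    rw [← ENNReal.toReal_eq_toReal_iff' hT hS]
    -- For s, t ≥ 1 the second factor vanishes only at s = t = 1.
    have h3 : (s.toReal - t.toReal) * (t.toReal * s.toReal + s.toReal + t.toReal - 3) = 0 := by
      linarith
    rcases mul_eq_zero.1 h3 with h4 | h4
    · linarith
    · nlinarith

theorem exists_devZ_eq {T : ℝ} (hT : T ∈ Set.Icc (0 : ℝ) 3) : ∃ t, 1 ≤ t ∧ devZ t = T := by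
  obtain ⟨h0, h3⟩ := hT
  rcases h3.eq_or_lt with rfl | h3
  · exact ⟨⊤, le_top, by simp [devZ]⟩
  have h3' : 0 < 3 - T := by linarith
  have hle : 1 ≤ √(3 * (1 + T) / (3 - T)) := by
    rw [Real.one_le_sqrt, le_div_iff₀ h3']; linarith
  refine ⟨ENNReal.ofReal √(3 * (1 + T) / (3 - T)), by simpa using hle, ?_⟩
  rw [devZ, if_neg ENNReal.ofReal_ne_top, ENNReal.toReal_ofReal (by linarith),
    Real.sq_sqrt (by positivity)]
  field_simp
  ring

theorem exists_devX_eq {T : ℝ} (hT : T ∈ Set.Icc (0 : ℝ) 3) : ∃ t, 1 ≤ t ∧ devX t = T := by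
  obtain ⟨h0, h3⟩ := hT
  rcases h0.eq_or_lt with rfl | h0
  · exact ⟨⊤, le_top, by simp [devX]⟩
  -- The witness (3 + r)/T is the larger root t of T(t² + 3) = 6(t + 1).
  set r := √(3 * ((1 + T) * (3 - T))) with hr
  have hr0 : 0 ≤ r := Real.sqrt_nonneg _
  have hr2 : r ^ 2 = 3 * ((1 + T) * (3 - T)) :=
    Real.sq_sqrt (by have := sub_nonneg.2 h3; positivity)
  have hle : 1 ≤ (3 + r) / T := by rw [le_div_iff₀ h0]; linarith
  refine ⟨ENNReal.ofReal ((3 + r) / T), by simpa using hle, ?_⟩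
  rw [devX, if_neg ENNReal.ofReal_ne_top, ENNReal.toReal_ofReal (by linarith),
    div_eq_iff (by positivity)]
  field_simp
  linear_combination -hr2

theorem deviation_pauliZ_le {ρ : Op} (hρ : IsState ρ) {t : ℝ≥0∞} (ht : 1 ≤ t)
    (hx : devX t ≤ deviation (outcomeProb pauliX ρ)) :
    deviation (outcomeProb pauliZ ρ) ≤ devZ t := by
  obtain ⟨⟨hz0, hz1⟩, -, htan⟩ := hρ.outcomeProb_properties
  have hz3 : deviation (outcomeProb pauliZ ρ) ≤ 3 := by simpa [hz1] using deviation_le hz0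
  have hz0 := deviation_nonneg (outcomeProb pauliZ ρ)
  generalize deviation (outcomeProb pauliZ ρ) = z at *
  generalize deviation (outcomeProb pauliX ρ) = x at *
  by_cases hT : t = ⊤
  · simpa [devZ, hT] using hz3
  have h1 := one_le_toReal ht hT
  rw [devX, if_neg hT] at hx
  rw [devZ, if_neg hT]
  generalize t.toReal = r at *
  rcases h1.eq_or_lt with rfl | h1
  · norm_num at hx ⊢
    by_contra! hz
    -- At t = 1 the tangent does not involve z; the one at 1 + z gives (1 + z) z² ≤ 0 instead.
    have h := htan (1 + z) (by linarith)
    have hx' := mul_le_mul_of_nonneg_left hx (show 0 ≤ 4 * (1 + z) by linarith)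
    have hp : 0 < (1 + z) * z ^ 2 := by positivity
    linarith
  · have hr : 0 < r ^ 2 + 3 := by positivity
    have h := htan r h1.le
    have hx' := mul_le_mul_of_nonneg_left hx (show 0 ≤ 4 * r by linarith)
    refine le_of_mul_le_mul_left ?_ (mul_pos (show 0 < r + 3 by linarith) (sub_pos.2 h1))
    have e : (r + 3) * (r - 1) * (3 * (r ^ 2 - 1) / (r ^ 2 + 3)) +
        4 * r * (6 * (r + 1) / (r ^ 2 + 3)) = 3 * (r + 1) ^ 2 := by
      field_simp; ring
    linarith

/-- The real amplitudes of `|ψ_t⟩`. -/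
noncomputable def realKet (t : ℝ≥0∞) (i : Fin 2 × Fin 2) : ℝ :=
  if t = ⊤ then (if i = (0, 0) then 1 else 0)
  else (if i = (0, 0) then t.toReal else 1) / √(3 + t.toReal ^ 2)

theorem ketPsi_eq (t : ℝ≥0∞) (i : Fin 2 × Fin 2) : ketPsi t i = (realKet t i : ℂ) := by
  unfold ketPsi realKet
  split_ifs <;> simp

theorem psi_apply_re (t : ℝ≥0∞) (i j : Fin 2 × Fin 2) :
    (psi t i j).re = ∑ _k : Unit, realKet t i * realKet t j := by
  simp [psi, Matrix.vecMulVec_apply, ketPsi_eq]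

theorem sq_realKet (t : ℝ≥0∞) (i : Fin 2 × Fin 2) :
    realKet t i ^ 2 = if i = (0, 0) then (1 + devZ t) / 4 else (3 - devZ t) / 12 := by
  unfold realKet devZ
  have h : (0 : ℝ) < 3 + t.toReal ^ 2 := by positivity
  split_ifs
  · norm_num
  · norm_num
  · rw [div_pow, Real.sq_sqrt h.le]; field_simp; ring
  · rw [div_pow, Real.sq_sqrt h.le]; field_simp; ring

theorem sq_hadamard_realKet (t : ℝ≥0∞) (i : Fin 2 × Fin 2) :
    hadamard (realKet t) i ^ 2 = if i = (0, 0) then (1 + devX t) / 4 else (3 - devX t) / 12 := by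
  have h : (0 : ℝ) < 3 + t.toReal ^ 2 := by positivity
  have h' := Real.sq_sqrt h.le
  have h0 : √(3 + t.toReal ^ 2) ≠ 0 := (Real.sqrt_pos.2 h).ne'
  obtain ⟨a, b⟩ := i
  by_cases hT : t = ⊤
  · fin_cases a <;> fin_cases b <;>
    simp [hadamard, realKet, devX, hT] <;> norm_num
  · fin_cases a <;> fin_cases b <;>
    simp [hadamard, realKet, devX, hT, Fintype.sum_prod_type, Fin.sum_univ_two] <;>
    field_simp <;> rw [h'] <;> ring

theorem sum_rpow_flat (q T : ℝ) :
    ∑ i : Fin 2 × Fin 2, (if i = (0, 0) then (1 + T) / 4 else (3 - T) / 12) ^ q = flatSum q T := by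
  simp [Fintype.sum_prod_type, Fin.sum_univ_two, flatSum]
  ring

theorem Szz_psi (q : ℝ) (t : ℝ≥0∞) : Szz q (psi t) = 1 / (q - 1) * (1 - flatSum q (devZ t)) := by
  rw [Szz, tsallis, outcomeProb_pauliZ (psi_apply_re t), ← sum_rpow_flat]
  simp [sq_realKet]

theorem Sxx_psi (q : ℝ) (t : ℝ≥0∞) : Sxx q (psi t) = 1 / (q - 1) * (1 - flatSum q (devX t)) := by
  rw [Sxx, tsallis, outcomeProb_pauliX (v := fun _ : Unit => realKet t) (psi_apply_re t),
    ← sum_rpow_flat]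
  simp [sq_hadamard_realKet]

theorem isState_psi (t : ℝ≥0∞) : IsState (psi t) := by
  refine ⟨Matrix.posSemidef_vecMulVec_self_star _, ?_⟩
  have h : ∑ i, realKet t i ^ 2 = 1 := by
    simp only [sq_realKet, Fintype.sum_prod_type, Fin.sum_univ_two]
    simp
    ring
  have : (psi t).trace = ((∑ i, realKet t i ^ 2 : ℝ) : ℂ) := by
    simp [Matrix.trace, psi, Matrix.vecMulVec_apply, ketPsi_eq, sq]
  rw [this, h, Complex.ofReal_one]

/-! ### The entropy bound and its closed form -/

theorem bound_eq {q : ℝ} (hq : 2 ≤ q) (t : ℝ≥0∞) :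
    bound q t = 1 / (q - 1) * (1 - flatSum q (devZ t)) := by
  by_cases hT : t = ⊤
  · simp [bound, devZ, hT, flatSum_three hq]
  · rw [bound, devZ, if_neg hT, if_neg hT, flatSum]
    have h0 := t.toReal_nonneg
    generalize t.toReal = r at *
    have h : (0 : ℝ) < 3 + r ^ 2 := by positivity
    have e1 : (1 + 3 * (r ^ 2 - 1) / (r ^ 2 + 3)) / 4 = r ^ 2 / (3 + r ^ 2) := by
      field_simp; ring
    have e2 : (3 - 3 * (r ^ 2 - 1) / (r ^ 2 + 3)) / 12 = 1 / (3 + r ^ 2) := by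
      field_simp; ring
    rw [e1, e2, Real.div_rpow (by positivity) h.le, Real.div_rpow zero_le_one h.le,
      Real.one_rpow, Real.rpow_mul h0, Real.rpow_two]
    ring

theorem tsallis_inj {q u v : ℝ} (hq : 2 ≤ q) :
    1 / (q - 1) * (1 - u) = 1 / (q - 1) * (1 - v) ↔ u = v := by
  have : 1 / (q - 1) ≠ 0 := one_div_ne_zero (by linarith)
  rw [mul_right_inj' this, sub_right_inj]

theorem bound_le_Szz {q q' : ℝ} (hq : 2 ≤ q) (hq' : 2 ≤ q') {ρ : Op} (hρ : IsState ρ) {t : ℝ≥0∞}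
    (ht : 1 ≤ t) (h : Sxx q' (psi t) = Sxx q' ρ) : bound q t ≤ Szz q ρ := by
  obtain ⟨⟨hz0, hz1⟩, ⟨hx0, hx1⟩, -⟩ := hρ.outcomeProb_properties
  rw [Sxx_psi, Sxx, tsallis, tsallis_inj hq'] at h
  have hx : devX t ≤ deviation (outcomeProb pauliX ρ) :=
    ((flatSum_strictMonoOn hq').le_iff_le (devX_mem ht)
      ⟨deviation_nonneg _, by simpa [hx1] using deviation_le hx0⟩).1
      (h.trans_le (sum_rpow_le_flatSum hq' hx0 hx1))
  have hz := (flatSum_strictMonoOn hq).monotoneOn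
    ⟨deviation_nonneg _, by simpa [hz1] using deviation_le hz0⟩ (devZ_mem ht)
    (deviation_pauliZ_le hρ ht hx)
  rw [bound_eq hq, Szz, tsallis]
  refine mul_le_mul_of_nonneg_left ?_ (one_div_nonneg.2 (by linarith))
  linarith [sum_rpow_le_flatSum hq hz0 hz1]

/-- Holds because `flatSum 2 T` = (3 + T²)/12. -/
theorem closedT_eq {T : ℝ} (h0 : 0 ≤ T) : closedT (1 / (2 - 1) * (1 - flatSum 2 T)) = T := by
  rw [closedT, flatSum, Real.rpow_two, Real.rpow_two, ← Real.sqrt_sq h0]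
  congr 1
  rw [Real.sqrt_sq h0]
  ring

theorem bound_two_eq_closedBound {t : ℝ≥0∞} (ht : 1 ≤ t) :
    bound 2 t = closedBound (Sxx 2 (psi t)) := by
  rw [closedBound, closedQ, Sxx_psi, closedT_eq (devX_mem ht).1]
  by_cases hT : t = ⊤
  · simp [bound, devX, hT]
  have h1 := one_le_toReal ht hT
  rw [bound, devX, if_neg hT, if_neg hT, show (2 : ℝ) * 2 = (4 : ℕ) by norm_num,
    Real.rpow_natCast, Real.rpow_two]
  generalize t.toReal = r at *
  have hr : r - 1 ≥ 0 := by linarith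
  have hs : √3 * √((1 + 6 * (r + 1) / (r ^ 2 + 3)) * (3 - 6 * (r + 1) / (r ^ 2 + 3))) =
      3 * (r - 1) * (r + 3) / (r ^ 2 + 3) := by
    rw [← Real.sqrt_mul (by norm_num), ← Real.sqrt_sq (show
      0 ≤ 3 * (r - 1) * (r + 3) / (r ^ 2 + 3) by positivity)]
    congr 1
    field_simp
    ring
  -- That is, Q = (r + 1) T.
  have hQ : 3 + 6 * (r + 1) / (r ^ 2 + 3) + 3 * (r - 1) * (r + 3) / (r ^ 2 + 3) =
      6 * (r + 1) ^ 2 / (r ^ 2 + 3) := by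
    field_simp; ring
  rw [hs, hQ]
  have : r + 1 ≠ 0 := by positivity
  field_simp
  ring

end TwoQubit

theorem corollary1 :
    (∀ q q' : ℝ, 2 ≤ q → 2 ≤ q' →
      (∀ t : ℝ≥0∞, 1 ≤ t →
        TwoQubit.IsState (TwoQubit.psi t) ∧
        TwoQubit.Szz q (TwoQubit.psi t) = TwoQubit.bound q t) ∧
      (∀ ρ : TwoQubit.Op, TwoQubit.IsState ρ →
        (∃! t : ℝ≥0∞, 1 ≤ t ∧ TwoQubit.Sxx q' (TwoQubit.psi t) = TwoQubit.Sxx q' ρ) ∧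
        (∀ t : ℝ≥0∞, 1 ≤ t → TwoQubit.Sxx q' (TwoQubit.psi t) = TwoQubit.Sxx q' ρ →
          TwoQubit.bound q t ≤ TwoQubit.Szz q ρ) ∧
        (∃ t : ℝ≥0∞, 1 ≤ t ∧ TwoQubit.Szz q (TwoQubit.psi t) = TwoQubit.Szz q ρ))) ∧
    (∀ ρ : TwoQubit.Op, TwoQubit.IsState ρ →
      0 ≤ 9 - 12 * TwoQubit.Sxx 2 ρ ∧
      0 ≤ (1 + TwoQubit.closedT (TwoQubit.Sxx 2 ρ)) *
        (3 - TwoQubit.closedT (TwoQubit.Sxx 2 ρ)) ∧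
      (∀ t : ℝ≥0∞, 1 ≤ t → TwoQubit.Sxx 2 (TwoQubit.psi t) = TwoQubit.Sxx 2 ρ →
        TwoQubit.bound 2 t = TwoQubit.closedBound (TwoQubit.Sxx 2 ρ)) ∧
      TwoQubit.closedBound (TwoQubit.Sxx 2 ρ) ≤ TwoQubit.Szz 2 ρ) := by
  have hex : ∀ q' : ℝ, 2 ≤ q' → ∀ ρ : TwoQubit.Op, TwoQubit.IsState ρ →
      ∃ t : ℝ≥0∞, 1 ≤ t ∧ TwoQubit.Sxx q' (TwoQubit.psi t) = TwoQubit.Sxx q' ρ := by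
    intro q' hq' ρ hρ
    obtain ⟨-, ⟨hx0, hx1⟩, -⟩ := hρ.outcomeProb_properties
    obtain ⟨T, hT, hTe⟩ := TwoQubit.exists_flatSum_eq hq' hx0 hx1
    obtain ⟨t, ht, rfl⟩ := TwoQubit.exists_devX_eq hT
    exact ⟨t, ht, by rw [TwoQubit.Sxx_psi, hTe, TwoQubit.Sxx, TwoQubit.tsallis]⟩
  refine ⟨fun q q' hq hq' => ⟨fun t ht => ⟨TwoQubit.isState_psi t, ?_⟩, fun ρ hρ =>
    ⟨?_, fun t ht h => TwoQubit.bound_le_Szz hq hq' hρ ht h, ?_⟩⟩, fun ρ hρ => ?_⟩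
  · rw [TwoQubit.Szz_psi, TwoQubit.bound_eq hq]
  · obtain ⟨t, ht, he⟩ := hex q' hq' ρ hρ
    refine ⟨t, ⟨ht, he⟩, fun s ⟨hs, hse⟩ => TwoQubit.devX_injOn hs ht ?_⟩
    rw [← he, TwoQubit.Sxx_psi, TwoQubit.Sxx_psi, TwoQubit.tsallis_inj hq'] at hse
    exact (TwoQubit.flatSum_strictMonoOn hq').injOn (TwoQubit.devX_mem hs) (TwoQubit.devX_mem ht) hse
  · obtain ⟨⟨hz0, hz1⟩, -, -⟩ := hρ.outcomeProb_properties
    obtain ⟨T, hT, hTe⟩ := TwoQubit.exists_flatSum_eq hq hz0 hz1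
    obtain ⟨t, ht, rfl⟩ := TwoQubit.exists_devZ_eq hT
    exact ⟨t, ht, by rw [TwoQubit.Szz_psi, hTe, TwoQubit.Szz, TwoQubit.tsallis]⟩
  · obtain ⟨t, ht, he⟩ := hex 2 le_rfl ρ hρ
    have hc : TwoQubit.closedT (TwoQubit.Sxx 2 ρ) = TwoQubit.devX t := by
      rw [← he, TwoQubit.Sxx_psi, TwoQubit.closedT_eq (TwoQubit.devX_mem ht).1]
    obtain ⟨h0, h3⟩ := TwoQubit.devX_mem ht
    have hall : ∀ s : ℝ≥0∞, 1 ≤ s → TwoQubit.Sxx 2 (TwoQubit.psi s) = TwoQubit.Sxx 2 ρ →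
        TwoQubit.bound 2 s = TwoQubit.closedBound (TwoQubit.Sxx 2 ρ) := fun s hs h => by
      rw [TwoQubit.bound_two_eq_closedBound hs, h]
    refine ⟨?_, ?_, hall, ?_⟩
    · rw [← he, TwoQubit.Sxx_psi, TwoQubit.flatSum, Real.rpow_two, Real.rpow_two]
      nlinarith [sq_nonneg (TwoQubit.devX t)]
    · rw [hc]
      exact mul_nonneg (by linarith) (by linarith)
    · rw [← hall t ht he]
      exact TwoQubit.bound_le_Szz le_rfl le_rfl hρ ht he
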